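/- Let $\mathfrak q$ be a finite-dimensional complex Lie algebra. Then there exist a finite-dimensional complex Lie algebra $\mathfrak g$ and an injective homomorphism of Lie algebras $\mathfrak q\hookrightarrow\mathfrak g$ such that (a) $\mathfrak g=\mathfrak p\ltimes\mathfrak n$ is the semidirect product of a reductive subalgebra $\mathfrak p$ and a nilpotent ideal $\mathfrak n$ (that is, $\mathfrak g=\mathfrak p\oplus\mathfrak n$ as a vector space), and (b) the action of $\mathfrak p$ on $\mathfrak n$ by the Lie bracket is completely reducible, i.e. every $\mathfrak p$-invariant subspace of $\mathfrak n$ has a $\mathfrak p$-invariant complement in $\mathfrak n$. -/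

import Mathlib

universe u

set_option linter.unusedSectionVars false

open Module

/-! Write `q = s + r` with `r` the radical and `s` a Levi subalgebra. The obstruction to taking `p =
s`, `n = r` is that `r` need not be nilpotent: its elements have Jordan decompositions whose
semisimple parts may be missing from `q`. These parts are adjoined as outer derivations.

Choose a nilpotent subalgebra `h` of `r` that centralizes `s` and satisfies `r = h + [q, r]`. For
`x` in `h` the semisimple part `D x` of `ad x` is a derivation, linear in `x`; the `D x` commute
with each other and kill both `s` and `h`. Let `t` be the space of all `D x` and put `g = q ⋊ t`, `p
= s + t`, `n = {x - D x : x ∈ h} + [q, r]`. Then `p` is reductive, since `t` is central in it. Each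
`x - D x` is ad-nilpotent, and by Lie's theorem adding an element of `[q, r]` preserves this, so `n`
is nilpotent by Engel's theorem. The sum `p + n` is direct because `D` vanishes on `h ∩ [q, r]`.
Finally `rad p` lies in `t`, which acts diagonalizably, so Weyl's theorem, in a form that allows a
central radical acting semisimply, gives complete reducibility.

The supporting results are Weyl's theorem (Casimir operator and Fitting decomposition), Levi's
theorem (deduced from Weyl's), and the nilpotency criterion `isNilpotent_toEnd_add_of_mem_lie`. -/

/-! ### Casimir operators -/

/-- **Casimir operator** of a space `W` of endomorphisms on which the trace form is nondegenerate. -/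
theorem Submodule.exists_casimir {k V : Type*} [Field k] [AddCommGroup V] [Module k V]
    [FiniteDimensional k V] (W : Submodule k (End k V))
    (hW : ∀ a ∈ W, (∀ b ∈ W, LinearMap.trace k V (a * b) = 0) → a = 0) :
    ∃ C ∈ W * W, LinearMap.trace k V C = finrank k W ∧
      ∀ X : End k V, (∀ a ∈ W, X * a - a * X ∈ W) → Commute X C := by
  classical
  let B : LinearMap.BilinForm k W :=
    ((LinearMap.mul k (End k V)).compr₂ (LinearMap.trace k V)).compl₁₂ W.subtype W.subtype
  have hB (a b : W) : B a b = LinearMap.trace k V (a.1 * b.1) := rfl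
  have hsymm (a b : W) : B a b = B b a := by rw [hB, hB, LinearMap.trace_mul_comm]
  have hnd : B.Nondegenerate := by
    refine ⟨fun a ha ↦ ?_, fun a ha ↦ ?_⟩
    · exact Subtype.ext (hW a a.2 fun b hb ↦ ha ⟨b, hb⟩)
    · exact Subtype.ext (hW a a.2 fun b hb ↦ (hsymm a ⟨b, hb⟩).trans (ha ⟨b, hb⟩))
  let b := finBasis k W
  let d := B.dualBasis hnd b
  have hdb (i j) : B (d i) (b j) = if j = i then 1 else 0 :=
    LinearMap.BilinForm.apply_dualBasis_left hnd b i j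
  have hbd (i j) : B (b i) (d j) = if i = j then 1 else 0 := by rw [hsymm, hdb]
  have hb (w : W) : w = ∑ j, B w (d j) • b j := by
    refine sub_eq_zero.mp (hnd.1 _ fun y ↦ ?_)
    rw [← d.sum_repr y, map_sum]
    refine Finset.sum_eq_zero fun j _ ↦ ?_
    simp [hbd]
  have hd (w : W) : w = ∑ j, B w (b j) • d j := by
    refine sub_eq_zero.mp (hnd.1 _ fun y ↦ ?_)
    rw [← b.sum_repr y, map_sum]
    refine Finset.sum_eq_zero fun j _ ↦ ?_
    simp [hdb]
  refine ⟨∑ i, (b i : End k V) * d i,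
    sum_mem fun i _ ↦ Submodule.mul_mem_mul (b i).2 (d i).2, ?_, fun X hX ↦ ?_⟩
  · rw [map_sum]
    simp [← hB, hbd]
  · let δ (a : W) : W := ⟨X * a - a * X, hX a a.2⟩
    -- Invariance of the trace form: `ad X` is skew. Hence its matrices in the two dual bases are
    -- negative transposes of each other, and the terms of `h1` cancel in pairs.
    have hδ (a c : W) : B (δ a) c = - B a (δ c) := by
      simp only [hB, δ]
      rw [eq_neg_iff_add_eq_zero, ← map_add]
      have : (X * a.1 - a.1 * X) * c.1 + a.1 * (X * c.1 - c.1 * X) =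
        X * (a.1 * c.1) - (a.1 * c.1) * X := by noncomm_ring
      rw [this, map_sub, LinearMap.trace_mul_comm, sub_self]
    have h1 : ∑ i, ((δ (b i) : End k V) * d i + b i * δ (d i)) = 0 := by
      rw [Finset.sum_add_distrib]
      have e1 (i) : (δ (b i) : End k V) * d i = ∑ j, B (δ (b i)) (d j) • ((b j : End k V) * d i) := by
        conv_lhs => rw [hb (δ (b i))]
        simp [Finset.sum_mul]
      have e2 (i) : (b i : End k V) * δ (d i) = ∑ j, B (δ (d i)) (b j) • ((b i : End k V) * d j) := by
        conv_lhs => rw [hd (δ (d i))]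
        simp [Finset.mul_sum]
      simp_rw [e1, e2]
      rw [Finset.sum_comm, ← Finset.sum_add_distrib]
      refine Finset.sum_eq_zero fun i _ ↦ ?_
      rw [← Finset.sum_add_distrib]
      refine Finset.sum_eq_zero fun j _ ↦ ?_
      rw [← add_smul, hδ, hsymm (b j), neg_add_cancel, zero_smul]
    rw [Commute, SemiconjBy, ← sub_eq_zero, ← h1, Finset.mul_sum, Finset.sum_mul,
      ← Finset.sum_sub_distrib]
    refine Finset.sum_congr rfl fun i _ ↦ ?_
    simp only [δ]
    noncomm_ring

/-! ### Solvable extensions, the radical and semisimple quotients -/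

namespace LieAlgebra

/-- An extension of a solvable Lie algebra by a solvable ideal is solvable. -/
theorem isSolvable_of_isSolvable_ker {R L L' : Type*} [CommRing R] [LieRing L] [LieAlgebra R L]
    [LieRing L'] [LieAlgebra R L'] (f : L →ₗ⁅R⁆ L') [IsSolvable L'] [IsSolvable f.ker] :
    IsSolvable L := by
  obtain ⟨m, hm⟩ := IsSolvable.solvable R L'
  obtain ⟨n, hn⟩ := IsSolvable.solvable R f.ker
  rw [LieIdeal.derivedSeries_eq_bot_iff] at hn
  have h : derivedSeriesOfIdeal R L m ⊤ ≤ f.ker := by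
    have := LieIdeal.derivedSeries_map_le (f := f) m
    rw [hm] at this
    rw [← LieIdeal.map_eq_bot_iff]
    exact le_bot_iff.mp this
  refine IsSolvable.mk (R := R) (k := n + m) ?_
  rw [derivedSeries_def, derivedSeriesOfIdeal_add, ← le_bot_iff, ← hn]
  exact derivedSeriesOfIdeal_mono h n

/-- The projection of a Lie algebra onto its quotient by an ideal. -/
def quotientMk {R L : Type*} [CommRing R] [LieRing L] [LieAlgebra R L] (I : LieIdeal R L) :
    L →ₗ⁅R⁆ L ⧸ I where
  toLinearMap := (LieSubmodule.Quotient.mk' I : L →ₗ[R] L ⧸ I)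
  map_lie' := fun {x y} ↦ LieSubmodule.Quotient.mk_bracket I x y

theorem quotientMk_surjective {R L : Type*} [CommRing R] [LieRing L] [LieAlgebra R L]
    (I : LieIdeal R L) : Function.Surjective (quotientMk I) :=
  LieSubmodule.Quotient.surjective_mk' I

@[simp] theorem quotientMk_eq_zero {R L : Type*} [CommRing R] [LieRing L] [LieAlgebra R L]
    {I : LieIdeal R L} {x : L} : quotientMk I x = 0 ↔ x ∈ I :=
  LieSubmodule.Quotient.mk_eq_zero I

variable {k L : Type*} [Field k] [LieRing L] [LieAlgebra k L] [FiniteDimensional k L]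

instance hasTrivialRadical_quotient_radical : HasTrivialRadical k (L ⧸ radical k L) := by
  refine hasTrivialRadical_of_no_solvable_ideals fun I hI ↦ ?_
  let J := LieIdeal.comap (quotientMk (radical k L)) I
  let f : J →ₗ⁅k⁆ I :=
    { toFun := fun x ↦ ⟨quotientMk (radical k L) x, x.2⟩
      map_add' := fun x y ↦ by ext; simp
      map_smul' := fun c x ↦ by ext; simp
      map_lie' := by intros; ext; simp }
  let g : f.ker →ₗ⁅k⁆ radical k L :=
    { toFun := fun x ↦ ⟨x.1.1, by
        have := x.2
        rw [LieHom.mem_ker, Subtype.ext_iff] at this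
        exact quotientMk_eq_zero.mp this⟩
      map_add' := fun x y ↦ rfl
      map_smul' := fun c x ↦ rfl
      map_lie' := rfl }
  have hg : Function.Injective g := fun x y h ↦ by
    exact Subtype.ext (Subtype.ext (congrArg (fun z : radical k L ↦ (z : L)) h))
  have : IsSolvable f.ker := hg.lieAlgebra_isSolvable
  have : IsSolvable J := isSolvable_of_isSolvable_ker f
  rw [LieIdeal.solvable_iff_le_radical] at this
  rw [LieSubmodule.eq_bot_iff]
  intro y hy
  obtain ⟨x, rfl⟩ := quotientMk_surjective _ y
  exact quotientMk_eq_zero.mpr (this hy)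

/-- A surjection onto a Lie algebra with trivial radical kills the radical. -/
theorem radical_le_ker {S : Type*} [LieRing S] [LieAlgebra k S] [FiniteDimensional k S]
    [HasTrivialRadical k S]
    (f : L →ₗ⁅k⁆ S) (hf : Function.Surjective f) : radical k L ≤ f.ker := by
  rw [← LieIdeal.map_eq_bot_iff]
  let g : radical k L →ₗ⁅k⁆ LieIdeal.map f (radical k L) :=
    { toFun := fun x ↦ ⟨f x, LieIdeal.mem_map x.2⟩
      map_add' := fun x y ↦ by ext; simp
      map_smul' := fun c x ↦ by ext; simp
      map_lie' := by intros; ext; simp }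
  have hg : Function.Surjective g := by
    rintro ⟨y, hy⟩
    obtain ⟨x, rfl⟩ := LieIdeal.mem_map_of_surjective hf hy
    exact ⟨x, rfl⟩
  have : IsSolvable (LieIdeal.map f (radical k L)) := hg.lieAlgebra_isSolvable
  exact HasTrivialRadical.eq_bot_of_isSolvable _

/-- The intersection of `I` with the Killing complement of `⁅I, I⁆` is an abelian ideal, hence zero.
-/
theorem lie_self_eq_self [IsKilling k L] (I : LieIdeal k L) : ⁅I, I⁆ = I := by
  refine le_antisymm (LieSubmodule.lie_le_right _ _) ?_
  have h := LieIdeal.isCompl_killingCompl ⁅I, I⁆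
  have h2 : I ⊓ LieIdeal.killingCompl k L ⁅I, I⁆ = ⊥ := by
    have : IsLieAbelian (I ⊓ LieIdeal.killingCompl k L ⁅I, I⁆ : LieIdeal k L) := by
      rw [LieSubmodule.lie_abelian_iff_lie_self_eq_bot, ← le_bot_iff, ← h.inf_eq_bot]
      exact le_inf (LieSubmodule.mono_lie inf_le_left inf_le_left)
        ((LieSubmodule.lie_le_right _ _).trans inf_le_right)
    exact IsKilling.ideal_eq_bot_of_isLieAbelian _
  intro x hx
  obtain ⟨y, hy, z, hz, rfl⟩ := (LieSubmodule.mem_sup _ _ _).mp (h.sup_eq_top ▸ LieSubmodule.mem_top x)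
  have hz' : z ∈ I := by
    simpa using sub_mem hx (LieSubmodule.lie_le_right I I hy)
  have : z ∈ I ⊓ LieIdeal.killingCompl k L ⁅I, I⁆ := ⟨hz', hz⟩
  rw [h2, LieSubmodule.mem_bot] at this
  simpa [this] using hy

end LieAlgebra

/-! ### Nondegeneracy of the trace form -/

namespace LieModule

open LieAlgebra

variable {k L V : Type*} [Field k] [CharZero k] [LieRing L] [LieAlgebra k L]
  [FiniteDimensional k L] [AddCommGroup V] [Module k V] [FiniteDimensional k V]
  [LieRingModule L V] [LieModule k L V]

/-- The kernel `N` of the trace form is an ideal, and it is perfect because `L` is semisimple. By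
Cartan's criterion `⁅N, N⁆ = N` acts nilpotently, and a perfect Lie algebra acting nilpotently acts
by zero. -/
theorem lie_eq_zero_of_traceForm_eq_zero_of_hasTrivialRadical [HasTrivialRadical k L] {x : L}
    (hx : ∀ y, traceForm k L V x y = 0) (v : V) : ⁅x, v⁆ = 0 := by
  let N : LieIdeal k L :=
    { toSubmodule := LinearMap.ker (traceForm k L V)
      lie_mem := by
        intro y z hz
        simp only [AddSubsemigroup.mem_carrier, AddSubmonoid.mem_toSubsemigroup,
          Submodule.mem_toAddSubmonoid, LinearMap.mem_ker] at hz ⊢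
        ext w
        rw [← lie_skew, map_neg, LinearMap.neg_apply, traceForm_apply_lie_apply, hz]
        simp }
  have hxN : x ∈ N := LinearMap.mem_ker.mpr (LinearMap.ext hx)
  have htr : traceForm k N V = 0 := by
    ext a b
    exact LinearMap.congr_fun (LinearMap.mem_ker.mp a.2) b.1
  have hnil := isNilpotent_derivedSeries_of_traceForm_eq_zero htr
  have hder : derivedSeries k N 1 = ⊤ := by
    rw [LieIdeal.derivedSeries_eq_derivedSeriesOfIdeal_comap, derivedSeriesOfIdeal_succ,
      derivedSeriesOfIdeal_zero, lie_self_eq_self]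
    ext; simp
  have hnil : IsNilpotent N V := by
    rw [isNilpotent_iff_forall' (R := k)] at hnil ⊢
    exact fun n ↦ hnil ⟨n, hder ▸ LieSubmodule.mem_top n⟩
  obtain ⟨m, hm⟩ := IsNilpotent.nilpotent k N V
  -- Each element of `N` is a sum of brackets `⁅a, b⁆`, and `abv - bav` lies one step deeper in the
  -- lower central series than `bv` and `av` do. So the depth gained by acting with `N` is
  -- unbounded.
  have key (j : ℕ) : ∀ i, ∀ v ∈ lowerCentralSeries k N V i, ∀ n : N,
      ⁅n, v⁆ ∈ lowerCentralSeries k N V (i + j) := by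
    induction j with
    | zero => exact fun i v hv n ↦ LieSubmodule.lie_mem _ hv
    | succ j ih =>
      intro i v hv n
      have hn : n ∈ (derivedSeries k N 1).toSubmodule := by rw [hder]; trivial
      rw [derivedSeries_def, derivedSeriesOfIdeal_succ, derivedSeriesOfIdeal_zero,
        LieSubmodule.lieIdeal_oper_eq_linear_span'] at hn
      induction hn using Submodule.span_induction with
      | mem n hn =>
        obtain ⟨a, -, b, -, rfl⟩ := hn
        rw [lie_lie, ← add_assoc, lowerCentralSeries_succ]
        exact sub_mem (LieSubmodule.lie_mem_lie (LieSubmodule.mem_top a) (ih i v hv b))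
          (LieSubmodule.lie_mem_lie (LieSubmodule.mem_top b) (ih i v hv a))
      | zero => simp
      | add n n' _ _ h h' => rw [add_lie]; exact add_mem h h'
      | smul c n _ h => rw [smul_lie]; exact SMulMemClass.smul_mem c h
  have := key m 0 v (LieSubmodule.mem_top v) ⟨x, hxN⟩
  rw [zero_add, hm] at this
  exact (LieSubmodule.mem_bot _).mp this

/-- A representation of `L` on which the kernel of a surjection `f : L → S` acts trivially
descends to `S`. -/
theorem _root_.LieHom.exists_descend {S A : Type*} [LieRing S] [LieAlgebra k S] [LieRing A]
    [LieAlgebra k A] (f : L →ₗ⁅k⁆ S) (hf : Function.Surjective f) (ρ : L →ₗ⁅k⁆ A)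
    (h : ∀ x, f x = 0 → ρ x = 0) :
    ∃ σ : S →ₗ⁅k⁆ A, ∀ x, σ (f x) = ρ x := by
  obtain ⟨g, hg⟩ := (f : L →ₗ[k] S).exists_rightInverse_of_surjective (LinearMap.range_eq_top.mpr hf)
  have hg (s : S) : f (g s) = s := LinearMap.congr_fun hg s
  have key (x y : L) (hxy : f x = f y) : ρ x = ρ y := by
    rw [← sub_eq_zero, ← map_sub]; exact h _ (by rw [map_sub, hxy, sub_self])
  exact ⟨{ toLinearMap := (ρ : L →ₗ[k] A) ∘ₗ g
           map_lie' := fun {a b} ↦ (key (g ⁅a, b⁆) ⁅g a, g b⁆ (by simp [hg])).trans (by simp) },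
    fun x ↦ key _ _ (hg _)⟩

attribute [local instance 100] LieRing.ofAssociativeRing in
theorem lie_eq_zero_of_traceForm_eq_zero (hrad : ∀ z ∈ radical k L, ∀ v : V, ⁅z, v⁆ = 0) {x : L}
    (hx : ∀ y, traceForm k L V x y = 0) (v : V) : ⁅x, v⁆ = 0 := by
  obtain ⟨σ, hσ⟩ := (quotientMk (radical k L)).exists_descend (quotientMk_surjective _)
    (toEnd k L V) (fun z hz ↦ LinearMap.ext (hrad z (quotientMk_eq_zero.mp hz)))
  let := LieRingModule.compLieHom V σ
  let := LieModule.compLieHom V σ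
  have h (y : L) (v : V) : ⁅quotientMk (radical k L) y, v⁆ = ⁅y, v⁆ :=
    LinearMap.congr_fun (hσ y) v
  have h' (y : L) : toEnd k _ V (quotientMk (radical k L) y) = toEnd k L V y :=
    LinearMap.ext (h y)
  rw [← h]
  refine lie_eq_zero_of_traceForm_eq_zero_of_hasTrivialRadical (k := k) (fun y ↦ ?_) v
  obtain ⟨y, rfl⟩ := quotientMk_surjective _ y
  rw [traceForm_apply_apply, h', h']
  exact hx y

end LieModule

/-! ### Weyl's theorem on complete reducibility -/

namespace LieModule

open LieAlgebra

variable {k L V : Type*} [Field k] [CharZero k] [LieRing L] [LieAlgebra k L]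
  [FiniteDimensional k L] [AddCommGroup V] [Module k V] [FiniteDimensional k V]
  [LieRingModule L V] [LieModule k L V]

variable (k L V) in
/-- The radical of `L` acts on `V` by semisimple endomorphisms commuting with the action of `L`. -/
structure IsReductiveAction : Prop where
  isSemisimple : ∀ z ∈ radical k L, (toEnd k L V z).IsSemisimple
  lie_comm : ∀ z ∈ radical k L, ∀ (y : L) (v : V), ⁅y, ⁅z, v⁆⁆ = ⁅z, ⁅y, v⁆⁆

theorem IsReductiveAction.submodule (h : IsReductiveAction k L V) (N : LieSubmodule k L V) :
    IsReductiveAction k L N where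
  isSemisimple z hz := (h.isSemisimple z hz).restrict (p := N.toSubmodule)
    (fun _ hv ↦ N.lie_mem hv)
  lie_comm z hz y v := Subtype.ext (h.lie_comm z hz y v)

theorem IsReductiveAction.of_radical_lie_eq_zero (h : ∀ z ∈ radical k L, ∀ v : V, ⁅z, v⁆ = 0) :
    IsReductiveAction k L V where
  isSemisimple z hz := by
    rw [show toEnd k L V z = 0 from LinearMap.ext (h z hz)]
    exact Module.End.isSemisimple_zero
  lie_comm z hz y v := by rw [h z hz, h z hz, lie_zero]

/-- An endomorphism commuting with `L`, and coming from the action of `L`, reduces the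
decomposition of `V` into invariants and coinvariants to its Fitting null component. -/
theorem isCompl_maxTriv_of_commute (C : End k V) (hcomm : ∀ x : L, Commute (toEnd k L V x) C)
    (hlie : ∀ U : LieSubmodule k L V, ∀ v ∈ U, C v ∈ ⁅(⊤ : LieIdeal k L), U⁆)
    (htriv : ∀ v ∈ maxTrivSubmodule k L V, C v = 0) (hnil : ¬ _root_.IsNilpotent C)
    (ih : ∀ U : LieSubmodule k L V, finrank k U < finrank k V →
      IsCompl (maxTrivSubmodule k L U) ⁅(⊤ : LieIdeal k L), (⊤ : LieSubmodule k L U)⁆) :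
    IsCompl (maxTrivSubmodule k L V) ⁅(⊤ : LieIdeal k L), (⊤ : LieSubmodule k L V)⁆ := by
  -- Fitting decomposition `V = V₀ ⊕ V₁` of `C`. The exponent is taken positive so that `C ^ n`
  -- kills the invariants. On `V₁` the operator `C` is bijective, which forces `V₁ = ⁅L, V₁⁆`; `V₀`
  -- is proper and falls under induction.
  obtain ⟨n, hn, hn1⟩ := (C.eventually_isCompl_ker_pow_range_pow.and
    (Filter.eventually_ge_atTop 1)).exists
  obtain ⟨m, rfl⟩ : ∃ m, n = m + 1 := ⟨n - 1, by omega⟩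
  have hc (x : L) (j : ℕ) (v : V) : (C ^ j) ⁅x, v⁆ = ⁅x, (C ^ j) v⁆ :=
    (LinearMap.congr_fun ((hcomm x).pow_right j) v).symm
  let V₀ : LieSubmodule k L V :=
    { toSubmodule := LinearMap.ker (C ^ (m + 1))
      lie_mem := fun {x v} hv ↦ by
        change (C ^ (m + 1)) v = 0 at hv
        change (C ^ (m + 1)) ⁅x, v⁆ = 0
        rw [hc, hv, lie_zero] }
  let V₁ : LieSubmodule k L V :=
    { toSubmodule := LinearMap.range (C ^ (m + 1))
      lie_mem := fun {x v} hv ↦ by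
        obtain ⟨u, rfl⟩ := hv
        exact ⟨⁅x, u⁆, hc x _ u⟩ }
  have hV₁ : V₁ ≤ ⁅(⊤ : LieIdeal k L), V₁⁆ := by
    rintro _ ⟨v, rfl⟩
    obtain ⟨a, ha, _, ⟨u, rfl⟩, rfl⟩ := Submodule.mem_sup.mp (hn.sup_eq_top ▸ Submodule.mem_top (x := v))
    rw [map_add, LinearMap.mem_ker.mp ha, zero_add, ← Module.End.mul_apply, pow_succ', mul_assoc]
    exact hlie V₁ _ ⟨(C ^ m) u, by
      rw [← pow_succ', ← Module.End.mul_apply, (Commute.refl C).pow_pow _ _]⟩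
  have hlt : finrank k V₀ < finrank k V := by
    refine Submodule.finrank_lt fun h ↦ hnil ⟨m + 1, ?_⟩
    exact LinearMap.ker_eq_top.mp h
  have h0 := ih V₀ hlt
  have hle : ⁅(⊤ : LieIdeal k L), V₀⁆ = LieSubmodule.map V₀.incl ⁅(⊤ : LieIdeal k L), (⊤ : LieSubmodule k L V₀)⁆ := by
    rw [LieSubmodule.map_bracket_eq]; simp
  have htop : (⊤ : LieSubmodule k L V) = V₀ ⊔ V₁ := by
    rw [← LieSubmodule.toSubmodule_inj, LieSubmodule.sup_toSubmodule]
    exact hn.sup_eq_top.symm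
  constructor
  · rw [disjoint_iff, LieSubmodule.eq_bot_iff]
    rintro v ⟨hv, hv'⟩
    have hv₀ : v ∈ V₀ := by
      change (C ^ (m + 1)) v = 0
      rw [pow_succ, Module.End.mul_apply, htriv v hv, map_zero]
    rw [SetLike.mem_coe, htop, LieSubmodule.lie_sup] at hv'
    obtain ⟨a, ha, b, hb, rfl⟩ := (LieSubmodule.mem_sup _ _ _).mp hv'
    have ha₀ : a ∈ V₀ := LieSubmodule.lie_le_right _ _ ha
    have hb₀ : b ∈ V₀ := by simpa using sub_mem hv₀ ha₀
    have hb1 : b = 0 := (Submodule.disjoint_def.mp hn.disjoint) b hb₀ (LieSubmodule.lie_le_right _ _ hb)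
    subst hb1
    rw [add_zero] at hv ⊢
    rw [hle] at ha
    obtain ⟨a, ha', rfl⟩ := (LieSubmodule.mem_map _).mp ha
    have : a ∈ maxTrivSubmodule k L V₀ := fun x ↦ Subtype.ext (hv x)
    have : a ∈ maxTrivSubmodule k L V₀ ⊓ ⁅(⊤ : LieIdeal k L), (⊤ : LieSubmodule k L V₀)⁆ := ⟨this, ha'⟩
    rw [h0.inf_eq_bot, LieSubmodule.mem_bot] at this
    rw [this, map_zero]
  · rw [codisjoint_iff, eq_top_iff, htop, sup_le_iff]
    constructor
    · intro v hv
      obtain ⟨a, ha, b, hb, hab⟩ := (LieSubmodule.mem_sup _ _ _).mp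
        (h0.sup_eq_top ▸ LieSubmodule.mem_top (⟨v, hv⟩ : V₀))
      have : v = a + b := (congrArg Subtype.val hab).symm
      rw [this]
      refine (LieSubmodule.mem_sup _ _ _).mpr ⟨a, fun x ↦ congrArg Subtype.val (ha x), b, ?_, rfl⟩
      have : (b : V) ∈ ⁅(⊤ : LieIdeal k L), V₀⁆ := hle ▸ LieSubmodule.mem_map_of_mem hb
      exact LieSubmodule.mono_lie_right _ le_sup_left this
    · exact (hV₁.trans (LieSubmodule.mono_lie_right _ le_sup_right)).trans le_sup_right

/-- If the radical acts by semisimple endomorphisms commuting with `L`, then every module is the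
direct sum of its invariants and its coinvariants. -/
theorem IsReductiveAction.isCompl_maxTriv (h : IsReductiveAction k L V) :
    IsCompl (maxTrivSubmodule k L V) ⁅(⊤ : LieIdeal k L), (⊤ : LieSubmodule k L V)⁆ := by
  induction hd : finrank k V using Nat.strong_induction_on generalizing V with
  | _ d ih
  subst hd
  have ih' (U : LieSubmodule k L V) (hU : finrank k U < finrank k V) :
      IsCompl (maxTrivSubmodule k L U) ⁅(⊤ : LieIdeal k L), (⊤ : LieSubmodule k L U)⁆ :=
    ih _ hU (h.submodule U) rfl
  -- The operator `C` is the Casimir operator of the image of `L` if the radical acts trivially, and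
  -- otherwise a radical element acting nontrivially. The first is not nilpotent because its trace
  -- is a nonzero dimension, the second because it is semisimple and nonzero.
  by_cases hrad : ∀ z ∈ radical k L, ∀ v : V, ⁅z, v⁆ = 0
  · by_cases htriv : IsTrivial L V
    · rw [(isTrivial_iff_max_triv_eq_top k L V).mp htriv, LieSubmodule.trivial_lie_oper_zero]
      exact isCompl_top_bot
    · let W := LinearMap.range (toEnd k L V : L →ₗ[k] End k V)
      obtain ⟨C, hCW, htr, hC⟩ := W.exists_casimir (by
        rintro _ ⟨x, rfl⟩ hx
        exact LinearMap.ext (lie_eq_zero_of_traceForm_eq_zero hrad fun y ↦ hx _ ⟨y, rfl⟩))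
      refine isCompl_maxTriv_of_commute C (fun x ↦ hC _ ?_) ?_ ?_ ?_ ih'
      · rintro _ ⟨y, rfl⟩
        exact ⟨⁅x, y⁆, by ext v; simp⟩
      · intro U v hv
        clear htr hC
        induction hCW using Submodule.mul_induction_on' with
        | mem_mul_mem a ha b hb =>
          obtain ⟨x, rfl⟩ := ha
          obtain ⟨y, rfl⟩ := hb
          exact LieSubmodule.lie_mem_lie (LieSubmodule.mem_top x) (U.lie_mem hv)
        | add a _ b _ ha hb => exact add_mem ha hb
      · intro v hv
        clear htr hC
        induction hCW using Submodule.mul_induction_on' with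
        | mem_mul_mem a ha b hb =>
          obtain ⟨x, rfl⟩ := ha
          obtain ⟨y, rfl⟩ := hb
          have : ⁅y, v⁆ = 0 := hv y
          change ⁅x, ⁅y, v⁆⁆ = 0
          rw [this, lie_zero]
        | add a _ b _ ha hb => rw [LinearMap.add_apply, ha, hb, add_zero]
      · intro hnil
        have h0 := (LinearMap.isNilpotent_trace_of_isNilpotent hnil).eq_zero
        rw [htr, Nat.cast_eq_zero, Submodule.finrank_eq_zero] at h0
        refine htriv ⟨fun x v ↦ ?_⟩
        have : toEnd k L V x ∈ W := ⟨x, rfl⟩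
        rw [h0, Submodule.mem_bot] at this
        exact LinearMap.congr_fun this v
  · push Not at hrad
    obtain ⟨z, hz, v, hv⟩ := hrad
    refine isCompl_maxTriv_of_commute (toEnd k L V z) (fun x ↦ LinearMap.ext (h.lie_comm z hz x))
      (fun U v hv ↦ LieSubmodule.lie_mem_lie (LieSubmodule.mem_top z) hv) (fun v hv ↦ hv z)
      (fun hnil ↦ hv ?_) ih'
    exact LinearMap.congr_fun
      (Module.End.eq_zero_of_isNilpotent_isSemisimple hnil (h.isSemisimple z hz)) v

/-- Invariant elements lift along surjections of modules. -/
theorem IsReductiveAction.exists_maxTriv_lift {M : Type*} [AddCommGroup M] [Module k M]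
    [LieRingModule L M] [LieModule k L M] [FiniteDimensional k M]
    (hM : IsReductiveAction k L M) (hV : IsReductiveAction k L V) (π : M →ₗ⁅k,L⁆ V)
    (hπ : Function.Surjective π) {v : V} (hv : v ∈ maxTrivSubmodule k L V) :
    ∃ m ∈ maxTrivSubmodule k L M, π m = v := by
  obtain ⟨m, rfl⟩ := hπ v
  obtain ⟨a, ha, b, hb, rfl⟩ := (LieSubmodule.mem_sup _ _ _).mp
    (hM.isCompl_maxTriv.sup_eq_top ▸ LieSubmodule.mem_top m)
  refine ⟨a, ha, ?_⟩
  have h1 : π b ∈ maxTrivSubmodule k L V := by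
    intro x
    have e := hv x
    rwa [map_add, lie_add, ← π.map_lie x a, ha x, map_zero, zero_add] at e
  have h2 : π b ∈ ⁅(⊤ : LieIdeal k L), (⊤ : LieSubmodule k L V)⁆ := by
    have := LieSubmodule.mem_map_of_mem (f := π) hb
    rw [LieSubmodule.map_bracket_eq] at this
    exact LieSubmodule.mono_lie_right _ le_top this
  have : π b ∈ maxTrivSubmodule k L V ⊓ ⁅(⊤ : LieIdeal k L), (⊤ : LieSubmodule k L V)⁆ := ⟨h1, h2⟩
  rw [hV.isCompl_maxTriv.inf_eq_bot, LieSubmodule.mem_bot] at this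
  rw [map_add, this, add_zero]

/-- An element `z` acts as postcomposition minus precomposition. Each is killed by the squarefree
minimal polynomial of `z` on `W` or on `V`; they commute, so in characteristic zero their difference
is semisimple. -/
theorem IsReductiveAction.linearMap {W : Type*} [AddCommGroup W] [Module k W]
    [FiniteDimensional k W] [LieRingModule L W] [LieModule k L W]
    (hV : IsReductiveAction k L V) (hW : IsReductiveAction k L W) :
    IsReductiveAction k L (V →ₗ[k] W) where
  isSemisimple z hz := by
    let α : End k W →ₐ[k] End k (V →ₗ[k] W) := 
      AlgHom.ofLinearMap (LinearMap.llcomp k V W W) (by ext; rfl) (fun _ _ ↦ by ext; rfl)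
    have hα := (hW.isSemisimple z hz).minpoly_squarefree
    have hα := Module.End.isSemisimple_of_squarefree_aeval_eq_zero hα
      (f := α (toEnd k L W z)) (by rw [Polynomial.aeval_algHom_apply, minpoly.aeval, map_zero])
    let β : End k (V →ₗ[k] W) := LinearMap.lcomp k W (toEnd k L V z)
    have hβ' (p : Polynomial k) : Polynomial.aeval β p = LinearMap.lcomp k W (Polynomial.aeval (toEnd k L V z) p) := by
      induction p using Polynomial.induction_on' with
      | add p q hp hq => rw [map_add, hp, hq, map_add]; ext; simp
      | monomial n a =>
        rw [Polynomial.aeval_monomial, Polynomial.aeval_monomial]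
        have (f : V →ₗ[k] W) : (β ^ n) f = f ∘ₗ (toEnd k L V z) ^ n := by
          induction n generalizing f with
          | zero => rfl
          | succ n ih => rw [pow_succ, Module.End.mul_apply, ih, pow_succ']; rfl
        ext f v
        simp [this]
    have hβ := Module.End.isSemisimple_of_squarefree_aeval_eq_zero (hV.isSemisimple z hz).minpoly_squarefree
      (f := β) (by rw [hβ', minpoly.aeval]; ext; simp)
    have hc : Commute (α (toEnd k L W z)) β := by ext; rfl
    rw [show toEnd k L (V →ₗ[k] W) z = α (toEnd k L W z) - β from rfl]
    exact hα.sub_of_commute hc hβ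
  lie_comm z hz y f := by
    ext v
    simp [hV.lie_comm z hz y v, hW.lie_comm z hz y]
    abel

/-- **Weyl's theorem** on complete reducibility. -/
theorem IsReductiveAction.complementedLattice (h : IsReductiveAction k L V) :
    ComplementedLattice (LieSubmodule k L V) := by
  refine ⟨fun W ↦ ?_⟩
  -- The identity of `W` is an invariant of `W →ₗ[k] W`. An invariant lift along restriction is an
  -- equivariant projection of `V` onto `W`, whose kernel is the complement.
  let π : (V →ₗ[k] W) →ₗ⁅k,L⁆ (W →ₗ[k] W) :=
    { toLinearMap := LinearMap.lcomp k W W.toSubmodule.subtype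
      map_lie' := rfl }
  have hπ : Function.Surjective π := by
    intro f
    exact LinearMap.exists_extend (p := W.toSubmodule) f
  have hid : (LinearMap.id : W →ₗ[k] W) ∈ maxTrivSubmodule k L (W →ₗ[k] W) := by
    intro x; ext; simp
  obtain ⟨e, he, he'⟩ := (h.linearMap (h.submodule W)).exists_maxTriv_lift
    ((h.submodule W).linearMap (h.submodule W)) π hπ hid
  have he1 (w : W) : e w = w := LinearMap.congr_fun he' w
  let e' : V →ₗ⁅k,L⁆ W :=
    { toLinearMap := e
      map_lie' := by
        intro x v
        have := LinearMap.congr_fun (he x) v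
        exact (sub_eq_zero.mp this).symm }
  refine ⟨e'.ker, ?_⟩
  rw [← LieSubmodule.isCompl_toSubmodule]
  exact LinearMap.isCompl_of_proj he1

end LieModule

/-! ### Levi's theorem -/

namespace LieModule

open LieAlgebra

variable {k L V : Type*} [Field k] [CharZero k] [LieRing L] [LieAlgebra k L]
  [FiniteDimensional k L] [AddCommGroup V] [Module k V] [FiniteDimensional k V]
  [LieRingModule L V] [LieModule k L V]

variable (k L V) in
/-- Inner derivations `z ↦ ⁅z, v⁆`, as a submodule of the linear maps. -/
def innerSubmodule : LieSubmodule k L (L →ₗ[k] V) where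
  carrier := {φ | ∃ v : V, ∀ z, φ z = ⁅z, v⁆}
  zero_mem' := ⟨0, by simp⟩
  add_mem' := by
    rintro φ ψ ⟨v, hv⟩ ⟨w, hw⟩
    exact ⟨v + w, by simp [hv, hw]⟩
  smul_mem' := by
    rintro c φ ⟨v, hv⟩
    exact ⟨c • v, by simp [hv]⟩
  lie_mem := by
    rintro x φ ⟨v, hv⟩
    exact ⟨⁅x, v⁆, fun z ↦ by rw [LieHom.lie_apply, hv, hv, lie_lie]; abel⟩

/-- Let `π : I → V` be equivariant, with the ideal `I ⊇ rad L` acting trivially on `V`.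
Then `π` extends to `L`, equivariantly up to inner derivations. -/
theorem exists_extend_mem_innerSubmodule (I : LieIdeal k L) (hI : radical k L ≤ I)
    (π : I →ₗ⁅k,L⁆ V) (hIV : ∀ x ∈ I, ∀ v : V, ⁅x, v⁆ = 0) :
    ∃ φ : L →ₗ[k] V, (∀ x : I, φ x = π x) ∧ ∀ y : L, ⁅y, φ⁆ ∈ innerSubmodule k L V := by
  -- `M` consists of the maps restricting to a multiple of `π` on `I`. Modulo inner maps the radical
  -- acts trivially on it: `⁅z, ψ⁆` is the inner map of `c • π z`. So Weyl's theorem applies to `M ⧸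
  -- P`.
  let M : LieSubmodule k L (L →ₗ[k] V) :=
    { carrier := {φ | ∃ c : k, ∀ x : I, φ x = c • π x}
      zero_mem' := ⟨0, by simp⟩
      add_mem' := by
        rintro φ ψ ⟨c, hc⟩ ⟨d, hd⟩
        exact ⟨c + d, by simp [hc, hd, add_smul]⟩
      smul_mem' := by
        rintro a φ ⟨c, hc⟩
        exact ⟨a * c, by simp [hc, mul_smul]⟩
      lie_mem := by
        rintro x φ ⟨c, hc⟩
        refine ⟨0, fun y ↦ ?_⟩
        have := hc ⁅x, y⁆
        rw [LieSubmodule.coe_bracket] at this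
        simp [hc, this] }
  let P : LieSubmodule k L M := (innerSubmodule k L V).comap M.incl
  have hlie (x : L) (ψ : M) (y : I) : (⁅x, ψ⁆ : M).1 y = 0 := by
    obtain ⟨ψ, c, hc⟩ := ψ
    have := hc ⁅x, y⁆
    rw [LieSubmodule.coe_bracket] at this
    simp [hc, this]
  have hred : IsReductiveAction k L (M ⧸ P) := by
    refine .of_radical_lie_eq_zero fun z hz n ↦ ?_
    obtain ⟨⟨ψ, c, hc⟩, rfl⟩ := LieSubmodule.Quotient.surjective_mk' P n
    rw [← LieModuleHom.map_lie, LieSubmodule.Quotient.mk_eq_zero]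
    refine ⟨c • π ⟨z, hI hz⟩, fun y ↦ ?_⟩
    have := hc ⁅y, ⟨z, hI hz⟩⁆
    rw [LieSubmodule.coe_bracket] at this
    simp only [LieSubmodule.incl_apply, LieSubmodule.coe_bracket, LieModuleHom.coe_toLinearMap, LieHom.lie_apply]
    rw [hIV z (hI hz), zero_sub, ← map_neg, lie_skew, this, LieModuleHom.map_lie, lie_smul]
  let N : LieSubmodule k L (M ⧸ P) := LieSubmodule.map (LieSubmodule.Quotient.mk' P)
    { carrier := {ψ : M | ∀ x : I, ψ.1 x = 0}
      zero_mem' := by simp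
      add_mem' := fun {a b} ha hb x ↦ by
        rw [LieSubmodule.coe_add, LinearMap.add_apply, ha x, hb x, add_zero]
      smul_mem' := fun c a ha x ↦ by
        rw [LieSubmodule.coe_smul, LinearMap.smul_apply, ha x, smul_zero]
      lie_mem := fun {x ψ} _ y ↦ hlie x ψ y }
  have hN : ⁅(⊤ : LieIdeal k L), (⊤ : LieSubmodule k L (M ⧸ P))⁆ ≤ N := by
    rw [LieSubmodule.lieIdeal_oper_eq_span, LieSubmodule.lieSpan_le]
    rintro _ ⟨⟨x, -⟩, ⟨n, -⟩, rfl⟩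
    obtain ⟨ψ, rfl⟩ := LieSubmodule.Quotient.surjective_mk' P n
    exact ⟨⁅x, ψ⁆, hlie x ψ, rfl⟩
  -- The class of any linear extension of `π` is an invariant plus a coinvariant. Coinvariants are
  -- represented by maps vanishing on `I`, and inner maps vanish on `I` too, so the invariant part
  -- still extends `π`.
  obtain ⟨φ₀, hφ₀⟩ := LinearMap.exists_extend (p := I.toSubmodule) (π : I →ₗ[k] V)
  have hφ₀ (x : I) : φ₀ x = π x := LinearMap.congr_fun hφ₀ x
  obtain ⟨a, ha, b, hb, hab⟩ := (LieSubmodule.mem_sup _ _ _).mp (hred.isCompl_maxTriv.sup_eq_top ▸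
    LieSubmodule.mem_top (LieSubmodule.Quotient.mk' P ⟨φ₀, 1, fun x ↦ by rw [hφ₀, one_smul]⟩))
  obtain ⟨ψ, hψ, rfl⟩ := (LieSubmodule.mem_map _).mp (hN hb)
  obtain ⟨φ, rfl⟩ := LieSubmodule.Quotient.surjective_mk' P a
  rw [← map_add, ← sub_eq_zero, ← map_sub, LieSubmodule.Quotient.mk_eq_zero] at hab
  obtain ⟨v, hv⟩ := hab
  refine ⟨φ, fun x ↦ ?_, fun y ↦ ?_⟩
  · have h1 := hv x
    rw [hIV x x.2] at h1
    have h2 : (φ : L →ₗ[k] V) x + (ψ : L →ₗ[k] V) x - φ₀ x = 0 := h1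
    rw [hψ x, hφ₀, add_zero] at h2
    exact sub_eq_zero.mp h2
  · have := ha y
    rwa [← LieModuleHom.map_lie, LieSubmodule.Quotient.mk_eq_zero] at this

/-- An ideal `I ⊇ rad L` can be replaced by its intersection with a subalgebra supplementing it, on
which a given trivial quotient of `I` vanishes. -/
theorem exists_lieSubalgebra_sup_eq_top (I : LieIdeal k L) (hI : radical k L ≤ I)
    (π : I →ₗ⁅k,L⁆ V) (hπ : Function.Surjective π) (hIV : ∀ x ∈ I, ∀ v : V, ⁅x, v⁆ = 0) :
    ∃ s : LieSubalgebra k L, (∀ x, ∃ y ∈ s, x - y ∈ I) ∧ ∀ y : I, (y : L) ∈ s → π y = 0 := by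
  obtain ⟨φ, hφ, hφ'⟩ := exists_extend_mem_innerSubmodule I hI π hIV
  have hV : IsReductiveAction k L V := .of_radical_lie_eq_zero fun z hz ↦ hIV z (hI hz)
  have hc := hV.isCompl_maxTriv
  rw [← LieSubmodule.isCompl_toSubmodule] at hc
  let e : V →ₗ[k] V := Submodule.projection _ _ hc
  have he (v : V) : e v ∈ maxTrivSubmodule k L V := Submodule.projection_apply_mem hc v
  have he' (v : V) (hv : v ∈ maxTrivSubmodule k L V) : e v = v :=
    Submodule.projection_apply_of_mem_left hc hv
  have hlie (x : L) (v : V) : e ⁅x, v⁆ = 0 := (Submodule.projection_apply_eq_zero_iff hc).mpr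
    (LieSubmodule.lie_mem_lie (LieSubmodule.mem_top x) (LieSubmodule.mem_top v))
  -- The stabilizer of `φ` alone would only force `π y` to be invariant for `y` in `I`; the
  -- condition on `e` removes this remaining part.
  let s : LieSubalgebra k L :=
    { carrier := {y | (∀ z, ⁅y, φ z⁆ = φ ⁅y, z⁆) ∧ e (φ y) = 0}
      zero_mem' := by simp
      add_mem' := fun {a b} ha hb ↦ ⟨fun z ↦ by simp [ha.1, hb.1], by simp [ha.2, hb.2]⟩
      smul_mem' := fun c a ha ↦ ⟨fun z ↦ by simp [ha.1], by simp [ha.2]⟩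
      lie_mem' := fun {a b} ha hb ↦ ⟨fun z ↦ by
        rw [lie_lie, hb.1, ha.1, ha.1, hb.1, lie_lie, map_sub], by rw [← ha.1, hlie]⟩ }
  refine ⟨s, fun x ↦ ?_, fun y hy ↦ ?_⟩
  · obtain ⟨v, hv⟩ := hφ' x
    obtain ⟨a, rfl⟩ := hπ v
    -- `x` and `a` move `φ` by the same inner map, that of `v = π a`.
    have h1 : ∀ z, ⁅x - a, φ z⁆ = φ ⁅x - a, z⁆ := by
      intro z
      have h2 : ⁅x, φ z⁆ - φ ⁅x, z⁆ = ⁅z, π a⁆ := hv z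
      have h3 : φ ⁅(a : L), z⁆ = - ⁅z, π a⁆ := by
        rw [← lie_skew, map_neg, ← LieModuleHom.map_lie, ← hφ, LieSubmodule.coe_bracket]
      rw [sub_lie, sub_lie, hIV a a.2, sub_zero, map_sub, h3, ← h2]
      abel
    obtain ⟨b, hb⟩ := hπ (e (φ (x - a)))
    refine ⟨x - a - b, ⟨fun z ↦ ?_, ?_⟩, ?_⟩
    · have h3 : φ ⁅(b : L), z⁆ = 0 := by
        rw [← lie_skew, map_neg, ← LieSubmodule.coe_bracket, hφ, LieModuleHom.map_lie, hb, he _ z, neg_zero]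
      rw [sub_lie _ (b : L), sub_lie _ (b : L), hIV b b.2, sub_zero, map_sub, h3, sub_zero, h1]
    · rw [map_sub, hφ, hb, map_sub, he' _ (he _), sub_self]
    · rw [show x - (x - (a : L) - b) = a + b by abel]
      exact add_mem a.2 b.2
  · have h1 : π y ∈ maxTrivSubmodule k L V := by
      intro z
      rw [← LieModuleHom.map_lie, ← hφ, LieSubmodule.coe_bracket, ← lie_skew, map_neg, ← hy.1 z,
        hIV y y.2, neg_zero]
    rw [← he' _ h1, ← hφ, hy.2]

end LieModule

namespace LieAlgebra

variable {k : Type*} [Field k] [CharZero k]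

/-- **Levi's theorem**: a surjection onto a semisimple Lie algebra with solvable kernel splits. -/
theorem exists_rightInverse_of_hasTrivialRadical {S : Type*} [LieRing S] [LieAlgebra k S]
    [FiniteDimensional k S] [HasTrivialRadical k S] {q : Type*} [LieRing q] [LieAlgebra k q]
    [FiniteDimensional k q] (f : q →ₗ⁅k⁆ S) (hf : Function.Surjective f) [IsSolvable f.ker] :
    ∃ σ : S →ₗ⁅k⁆ q, ∀ x, f (σ x) = x := by
  induction hd : finrank k q using Nat.strong_induction_on generalizing q with
  | _ d ih
  subst hd
  by_cases hinj : f.ker = ⊥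
  · let e := LieEquiv.ofBijective f ⟨(LieHom.ker_eq_bot f).mp hinj, hf⟩
    exact ⟨e.symm, fun x ↦ e.apply_symm_apply x⟩
  -- Apply the splitting to `V = r ⧸ ⁅r, r⁆` with `r = f.ker`. The resulting `s` still maps onto `S`
  -- and meets `r` inside `⁅r, r⁆ ≠ r`, so it is a proper subalgebra and induction applies.
  · let D : LieSubmodule k q f.ker := ⁅f.ker, (⊤ : LieSubmodule k q f.ker)⁆
    obtain ⟨s, hs, hs'⟩ := LieModule.exists_lieSubalgebra_sup_eq_top f.ker (radical_le_ker f hf)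
      (LieSubmodule.Quotient.mk' D) (LieSubmodule.Quotient.surjective_mk' D) (by
        intro x hx v
        obtain ⟨v, rfl⟩ := LieSubmodule.Quotient.surjective_mk' D v
        rw [← LieModuleHom.map_lie, LieSubmodule.Quotient.mk_eq_zero]
        exact LieSubmodule.lie_mem_lie hx (LieSubmodule.mem_top v))
    have hlt : finrank k s < finrank k q := by
      refine Submodule.finrank_lt (s := s.toSubmodule) fun h ↦ ?_
      have : Nontrivial f.ker := (LieSubmodule.nontrivial_iff_ne_bot k q q).mpr hinj
      refine (derivedSeries_lt_top_of_solvable k f.ker).ne (eq_top_iff.mpr (SetLike.le_def.mpr ?_))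
      rintro y -
      have hy := (LieSubmodule.Quotient.mk_eq_zero D).mp (hs' y (by
        rw [← LieSubalgebra.mem_toSubmodule, h]; trivial))
      rw [← LieSubmodule.mem_toSubmodule, LieSubmodule.lieIdeal_oper_eq_linear_span'] at hy
      induction hy using Submodule.span_induction with
      | mem n hn =>
        obtain ⟨a, ha, b, -, rfl⟩ := hn
        rw [derivedSeries_def, derivedSeriesOfIdeal_succ, derivedSeriesOfIdeal_zero]
        exact LieSubmodule.lie_mem_lie (LieSubmodule.mem_top (⟨a, ha⟩ : f.ker))
          (LieSubmodule.mem_top b)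
      | zero => exact zero_mem _
      | add n n' _ _ h h' => exact add_mem h h'
      | smul c n _ h => exact SMulMemClass.smul_mem c h
    let g : s →ₗ⁅k⁆ S := f.comp s.incl
    have hg : Function.Surjective g := by
      intro y
      obtain ⟨x, rfl⟩ := hf y
      obtain ⟨y, hy, hxy⟩ := hs x
      refine ⟨⟨y, hy⟩, ?_⟩
      rw [LieHom.mem_ker, map_sub, sub_eq_zero] at hxy
      exact hxy.symm
    have : IsSolvable g.ker := by
      let j : g.ker →ₗ⁅k⁆ f.ker :=
        { toFun := fun x ↦ ⟨x.1.1, x.2⟩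
          map_add' := fun x y ↦ rfl
          map_smul' := fun c x ↦ rfl
          map_lie' := rfl }
      have hj : Function.Injective j := fun x y h ↦
        Subtype.ext (Subtype.ext (congrArg (fun z : f.ker ↦ (z : q)) h))
      exact hj.lieAlgebra_isSolvable
    obtain ⟨σ, hσ⟩ := ih _ hlt g hg rfl
    exact ⟨s.incl.comp σ, hσ⟩

end LieAlgebra

/-! ### Lie's theorem and nilpotency -/

namespace LieModule

open LieAlgebra

attribute [local instance 100] LieRing.ofAssociativeRing in
/-- Elements of `⁅L, I⁆`, for a solvable ideal `I`, do not contribute to the eigenvalues of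
elements of `I`. -/
theorem isNilpotent_toEnd_add_of_mem_lie {k L V : Type*} [Field k] [CharZero k] [IsAlgClosed k]
    [LieRing L] [LieAlgebra k L] [AddCommGroup V] [Module k V] [FiniteDimensional k V]
    [LieRingModule L V] [LieModule k L V] (I : LieIdeal k L) [IsSolvable I] {x y : L} (hx : x ∈ I)
    (hxn : _root_.IsNilpotent (toEnd k L V x)) (hy : y ∈ ⁅(⊤ : LieIdeal k L), I⁆) :
    _root_.IsNilpotent (toEnd k L V (x + y)) := by
  induction hd : finrank k V using Nat.strong_induction_on generalizing V with
  | _ d ih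
  subst hd
  cases subsingleton_or_nontrivial V
  · exact ⟨1, Subsingleton.elim _ _⟩
  -- Lie's theorem gives a nonzero weight space `W` of `I`, stable under `L`. Both `x` and `y` kill
  -- it: `χ x = 0` by nilpotency, and a bracket acts on `W` by a scalar of trace zero. Induction
  -- applies to `V ⧸ W`.
  obtain ⟨χ, hχ⟩ := exists_nontrivial_weightSpace_of_isSolvable k I V
  let W : LieSubmodule k L V := weightSpaceOfIsLieTower k V χ
  have hW (a : I) (w : V) (hw : w ∈ W) : ⁅(a : L), w⁆ = χ a • w := (mem_weightSpace (M := V) (R := k) χ w).mp hw a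
  obtain ⟨⟨w, hw⟩, hw0⟩ := exists_ne (0 : weightSpace V χ)
  replace hw0 : w ≠ 0 := fun h ↦ hw0 (Subtype.ext h)
  have : Nontrivial W := ⟨⟨w, hw⟩, 0, fun h ↦ hw0 (congrArg Subtype.val h)⟩
  have hχx : χ ⟨x, hx⟩ = 0 := by
    obtain ⟨n, hn⟩ := hxn
    have key : ((toEnd k L V x) ^ n) w = χ ⟨x, hx⟩ ^ n • w := by
      clear hn
      induction n with
      | zero => simp
      | succ n ihn => rw [pow_succ', Module.End.mul_apply, ihn, map_smul, toEnd_apply_apply,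
          hW ⟨x, hx⟩ w hw, smul_smul, pow_succ]
    rw [hn, LinearMap.zero_apply, eq_comm, smul_eq_zero] at key
    exact eq_zero_of_pow_eq_zero (key.resolve_right hw0)
  have hyI : y ∈ I := LieSubmodule.lie_le_right _ _ hy
  have hyW : ∀ w ∈ W, ⁅y, w⁆ = 0 := by
    rw [← LieSubmodule.mem_toSubmodule, LieSubmodule.lieIdeal_oper_eq_linear_span'] at hy
    clear hyI ih
    induction hy using Submodule.span_induction with
    | mem n hn =>
      obtain ⟨a, -, b, hb, rfl⟩ := hn
      have h1 : toEnd k L W ⁅a, b⁆ = χ ⟨⁅a, b⁆, I.lie_mem hb⟩ • LinearMap.id :=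
        LinearMap.ext fun w ↦ Subtype.ext (hW ⟨_, I.lie_mem hb⟩ w w.2)
      have h2 := congrArg (LinearMap.trace k W) h1
      rw [LieHom.map_lie, LinearMap.trace_lie, map_smul, LinearMap.trace_id, eq_comm, smul_eq_mul,
        mul_eq_zero, Nat.cast_eq_zero] at h2
      intro w hw
      rw [hW ⟨_, I.lie_mem hb⟩ w hw, h2.resolve_right finrank_pos.ne', zero_smul]
    | zero => simp
    | add n n' _ _ h h' => intro w hw; rw [add_lie, h w hw, h' w hw, add_zero]
    | smul c n _ h => intro w hw; rw [smul_lie, h w hw, smul_zero]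
  have hpow (z : L) (n : ℕ) (v : V) : ((toEnd k L (V ⧸ W) z) ^ n) (LieSubmodule.Quotient.mk' W v) =
      LieSubmodule.Quotient.mk' W (((toEnd k L V z) ^ n) v) := by
    induction n with
    | zero => rfl
    | succ n ihn => rw [pow_succ', Module.End.mul_apply, ihn, pow_succ', Module.End.mul_apply]; rfl
  have hlt : finrank k (V ⧸ W) < finrank k V := by
    have h1 := W.toSubmodule.finrank_quotient_add_finrank
    have h2 : 0 < finrank k W := finrank_pos
    change finrank k (V ⧸ W.toSubmodule) < _
    have h3 : finrank k W = finrank k W.toSubmodule := rfl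
    omega
  obtain ⟨n, hn⟩ := hxn
  obtain ⟨m, hm⟩ := ih _ hlt (V := V ⧸ W) ⟨n, LinearMap.ext fun v ↦ by
    obtain ⟨v, rfl⟩ := LieSubmodule.Quotient.surjective_mk' W v
    rw [hpow, hn]; simp⟩ rfl
  refine ⟨m + 1, LinearMap.ext fun v ↦ ?_⟩
  have h1 := hpow (x + y) m v
  rw [hm, LinearMap.zero_apply, eq_comm, LieSubmodule.Quotient.mk_eq_zero] at h1
  rw [pow_succ', Module.End.mul_apply, toEnd_apply_apply, add_lie, hyW _ h1, hW ⟨x, hx⟩ _ h1, hχx]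
  simp

end LieModule

/-! ### A nilpotent supplement of `[q, rad q]` in the radical -/

namespace LieAlgebra

variable {k q : Type*} [Field k] [CharZero k] [IsAlgClosed k] [LieRing q] [LieAlgebra k q]
  [FiniteDimensional k q]

open LieModule

theorem isNilpotent_ad_of_mem_lie_radical {x : q} (hx : x ∈ ⁅(⊤ : LieIdeal k q), radical k q⁆) :
    IsNilpotent (ad k q x) := by
  have := isNilpotent_toEnd_add_of_mem_lie (V := q) (radical k q) (zero_mem _) (by simp) hx
  rwa [zero_add] at this

/-- In a Lie algebra over an infinite field, a Cartan subalgebra is a complement to the derived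
algebra, up to intersection. -/
theorem exists_isNilpotent_sup_lie_eq_top :
    ∃ H : LieSubalgebra k q, LieRing.IsNilpotent H ∧
      ∀ x : q, ∃ y ∈ H, x - y ∈ ⁅(⊤ : LieIdeal k q), (⊤ : LieIdeal k q)⁆ := by
  obtain ⟨z, hz⟩ := exists_isCartanSubalgebra_engel k q
  set H := LieSubalgebra.engel k z
  refine ⟨H, inferInstance, fun x ↦ ?_⟩
  -- The Fitting null component of a Cartan subalgebra is the subalgebra itself, and the positive
  -- component consists of sums of brackets.
  have h := isCompl_genWeightSpace_zero_posFittingComp k H q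
  obtain ⟨y, hy, w, hw, rfl⟩ := (LieSubmodule.mem_sup _ _ _).mp (h.sup_eq_top ▸ LieSubmodule.mem_top x)
  refine ⟨y, ?_, ?_⟩
  · rw [← LieAlgebra.rootSpace, LieAlgebra.rootSpace_zero_eq] at hy
    exact hy
  · have hw := (posFittingComp_le_iInf_lowerCentralSeries k H q).trans (iInf_le _ 1) hw
    rw [lowerCentralSeries_succ, ← LieSubmodule.mem_toSubmodule,
      LieSubmodule.lieIdeal_oper_eq_linear_span'] at hw
    rw [add_sub_cancel_left, ← LieSubmodule.mem_toSubmodule]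
    refine Submodule.span_le.mpr ?_ hw
    rintro _ ⟨a, -, b, -, rfl⟩
    exact LieSubmodule.lie_mem_lie (LieSubmodule.mem_top (a : q)) (LieSubmodule.mem_top b)

/-- The radical is the sum of `⁅q, rad q⁆` and a nilpotent subalgebra centralizing a given
semisimple subalgebra. -/
theorem exists_isNilpotent_radical_le_sup {S : Type*} [LieRing S] [LieAlgebra k S]
    [FiniteDimensional k S] [HasTrivialRadical k S] (σ : S →ₗ⁅k⁆ q) :
    ∃ h : LieSubalgebra k q, LieRing.IsNilpotent h ∧ (∀ x ∈ h, x ∈ radical k q) ∧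
      (∀ x ∈ h, ∀ s, ⁅σ s, x⁆ = 0) ∧
      ∀ x ∈ radical k q, ∃ y ∈ h, x - y ∈ ⁅(⊤ : LieIdeal k q), radical k q⁆ := by
  -- The centralizer of the Levi subalgebra in the radical. By Weyl's theorem `rad q = c + [σ S, rad
  -- q]`, and a Cartan subalgebra of `c` supplements `[c, c]`, so it serves as `h`.
  let c : LieSubalgebra k q :=
    { carrier := {x | x ∈ radical k q ∧ ∀ s, ⁅σ s, x⁆ = 0}
      zero_mem' := by simp
      add_mem' := fun {a b} ha hb ↦ ⟨add_mem ha.1 hb.1, fun s ↦ by rw [lie_add, ha.2, hb.2, add_zero]⟩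
      smul_mem' := fun t a ha ↦ ⟨SMulMemClass.smul_mem t ha.1, fun s ↦ by rw [lie_smul, ha.2, smul_zero]⟩
      lie_mem' := fun {a b} ha hb ↦ ⟨(radical k q).lie_mem hb.1, fun s ↦ by
        rw [leibniz_lie, ha.2, hb.2, zero_lie, lie_zero, add_zero]⟩ }
  obtain ⟨H, hH, hHc⟩ := exists_isNilpotent_sup_lie_eq_top (k := k) (q := c)
  refine ⟨(c.incl.comp H.incl).range, LieHom.isNilpotent_range _, ?_, ?_, fun x hx ↦ ?_⟩
  · rintro _ ⟨x, rfl⟩; exact x.1.2.1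
  · rintro _ ⟨x, rfl⟩; exact x.1.2.2
  · let : LieRingModule S q := LieRingModule.compLieHom q σ
    let : LieModule k S q := LieModule.compLieHom q σ
    let R : LieSubmodule k S q :=
      { toSubmodule := (radical k q).toSubmodule
        lie_mem := fun {s x} hx ↦ (radical k q).lie_mem (x := σ s) hx }
    have hR : IsReductiveAction k S R := .of_radical_lie_eq_zero (by simp)
    obtain ⟨a, ha, b, hb, hab⟩ := (LieSubmodule.mem_sup _ _ _).mp
      (hR.isCompl_maxTriv.sup_eq_top ▸ LieSubmodule.mem_top (⟨x, hx⟩ : R))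
    obtain ⟨y, hy, hay⟩ := hHc ⟨a, a.2, fun s ↦ congrArg Subtype.val (ha s)⟩
    refine ⟨y, ⟨⟨y, hy⟩, rfl⟩, ?_⟩
    have h1 : (b : q) ∈ ⁅(⊤ : LieIdeal k q), radical k q⁆ := by
      clear hab
      rw [← LieSubmodule.mem_toSubmodule, LieSubmodule.lieIdeal_oper_eq_linear_span'] at hb
      induction hb using Submodule.span_induction with
      | mem n hn =>
        obtain ⟨s, -, b, -, rfl⟩ := hn
        exact LieSubmodule.lie_mem_lie (LieSubmodule.mem_top (σ s)) b.2
      | zero => exact zero_mem _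
      | add n n' _ _ h h' => exact add_mem h h'
      | smul c n _ h => exact SMulMemClass.smul_mem c h
    have h2 : (a : q) - y ∈ ⁅(⊤ : LieIdeal k q), radical k q⁆ := by
      change ((⟨a, a.2, fun s ↦ congrArg Subtype.val (ha s)⟩ - y : c) : q) ∈ _
      generalize (⟨a, a.2, fun s ↦ congrArg Subtype.val (ha s)⟩ - y : c) = w at hay ⊢
      rw [← LieSubmodule.mem_toSubmodule, LieSubmodule.lieIdeal_oper_eq_linear_span'] at hay
      induction hay using Submodule.span_induction with
      | mem n hn =>
        obtain ⟨s, -, b, -, rfl⟩ := hn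
        exact LieSubmodule.lie_mem_lie (LieSubmodule.mem_top (s : q)) b.2.1
      | zero => exact zero_mem _
      | add n n' _ _ h h' => exact add_mem h h'
      | smul c n _ h => exact SMulMemClass.smul_mem c h
    have h3 : x = a + b := (congrArg Subtype.val hab).symm
    rw [h3, add_sub_right_comm]
    exact add_mem h2 h1

end LieAlgebra

/-! ### Semisimple parts of the adjoint action -/

theorem Module.End.isSemisimple_of_iSup_eigenspace_eq_top {k V : Type*} [Field k] [AddCommGroup V]
    [Module k V] [FiniteDimensional k V] {f : End k V} (h : ⨆ μ, f.eigenspace μ = ⊤) :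
    f.IsSemisimple := by
  classical
  let s := (Module.End.finite_hasEigenvalue f).toFinset
  refine isSemisimple_of_squarefree_aeval_eq_zero
    (p := ∏ μ ∈ s, (Polynomial.X - Polynomial.C μ))
    (Polynomial.separable_prod_X_sub_C_iff'.mpr fun _ _ _ _ h ↦ h).squarefree ?_
  refine LinearMap.ker_eq_top.mp (top_le_iff.mp (h ▸ iSup_le fun μ v hv ↦ ?_))
  rw [LinearMap.mem_ker]
  by_cases h0 : v = 0
  · rw [h0, map_zero]
  rw [Module.End.aeval_apply_of_hasEigenvector ⟨hv, h0⟩, Polynomial.eval_prod, Finset.prod_eq_zero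
    (i := μ), zero_smul]
  · exact (Set.Finite.mem_toFinset _).mpr (Module.End.hasEigenvalue_of_hasEigenvector ⟨hv, h0⟩)
  · simp

/-- If `(f - c) ^ n` kills `v` and `c ≠ 0`, then `v` is in the range of `f`. -/
theorem Module.End.mem_range_of_pow_sub_algebraMap_apply_eq_zero {k V : Type*} [Field k] [AddCommGroup V]
    [Module k V] {f : End k V} {c : k} (hc : c ≠ 0) (n : ℕ) :
    ∀ v, ((f - c • 1) ^ n) v = 0 → v ∈ LinearMap.range f := by
  induction n with
  | zero => rintro v (rfl : v = 0); exact zero_mem _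
  | succ n ih =>
    intro v hv
    have h1 := ih _ hv
    have h2 : v = c⁻¹ • (f v - (f - c • 1) v) := by simp [hc]
    rw [h2]
    exact Submodule.smul_mem _ _ (sub_mem ⟨v, rfl⟩ h1)

namespace LieAlgebra

variable {k q : Type*} [Field k] [CharZero k] [IsAlgClosed k] [LieRing q] [LieAlgebra k q]
  [FiniteDimensional k q]

open LieModule

theorem mem_of_forall_genWeightSpace_le (h : LieSubalgebra k q) [LieRing.IsNilpotent h]
    (p : Submodule k q) (hp : ∀ χ : h → k, (genWeightSpace q χ).toSubmodule ≤ p) (v : q) : v ∈ p := by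
  have h1 := iSup_genWeightSpace_eq_top k h q
  rw [← LieSubmodule.toSubmodule_inj, LieSubmodule.iSup_toSubmodule] at h1
  exact iSup_le hp (h1 ▸ Submodule.mem_top)

/-- `D x` acts on every generalized weight space of `h` by the corresponding value of the weight;
that is, `D x` is the semisimple part of `ad x`. -/
def IsSemisimplePart {h : LieSubalgebra k q} [LieRing.IsNilpotent h]
    (D : h →ₗ[k] LieDerivation k q q) : Prop :=
  ∀ (χ : h → k), ∀ v ∈ genWeightSpace q χ, ∀ x, D x v = χ x • v

/-- The semisimple parts of the adjoint action of a nilpotent subalgebra, as derivations. -/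
theorem exists_isSemisimplePart (h : LieSubalgebra k q) [LieRing.IsNilpotent h] :
    ∃ D : h →ₗ[k] LieDerivation k q q, IsSemisimplePart D := by
  classical
  have hint : DirectSum.IsInternal fun χ : Weight k h q ↦ (genWeightSpace q χ).toSubmodule := by
    rw [DirectSum.isInternal_submodule_iff_iSupIndep_and_iSup_eq_top]
    refine ⟨?_, ?_⟩
    · exact LieSubmodule.iSupIndep_toSubmodule.mpr (iSupIndep_genWeightSpace' k h q)
    · rw [← LieSubmodule.iSup_toSubmodule, iSup_genWeightSpace_eq_top' k h q]; rfl
  let e := LinearEquiv.ofBijective (DirectSum.coeLinearMap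
    fun χ : Weight k h q ↦ (genWeightSpace q χ).toSubmodule) hint
  let E (x : h) : q →ₗ[k] q := (DirectSum.toModule k _ q fun χ : Weight k h q ↦
    χ x • (genWeightSpace q χ).toSubmodule.subtype) ∘ₗ e.symm
  have hE (χ : h → k) (v : q) (hv : v ∈ genWeightSpace q χ) (x : h) : E x v = χ x • v := by
    by_cases hχ : genWeightSpace q χ = ⊥
    · rw [hχ, LieSubmodule.mem_bot] at hv
      rw [hv, map_zero, smul_zero]
    · let χ' : Weight k h q := ⟨χ, hχ⟩
      have h1 : e.symm v = DirectSum.lof k _ (fun χ : Weight k h q ↦ (genWeightSpace q χ).toSubmodule)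
          χ' ⟨v, hv⟩ := by
        rw [LinearEquiv.symm_apply_eq]
        exact (DirectSum.coeLinearMap_lof
          (fun χ : Weight k h q ↦ (genWeightSpace q χ).toSubmodule) χ' ⟨v, hv⟩).symm
      change DirectSum.toModule k _ q _ (e.symm v) = _
      rw [h1, DirectSum.toModule_lof]
      rfl
  let F (x : h) : LieDerivation k q q :=
    { toLinearMap := E x
      leibniz' := fun a b ↦ by
        let B : q →ₗ[k] q →ₗ[k] q := (toEnd k q q : q →ₗ[k] q →ₗ[k] q)
        let p : Submodule k q := LinearMap.ker
          (B.compr₂ (E x) - B.compl₂ (E x) - B.comp (E x))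
        have hp (a : q) : a ∈ p ↔ ∀ b, E x ⁅a, b⁆ - ⁅a, E x b⁆ - ⁅E x a, b⁆ = 0 :=
          LinearMap.ext_iff
        have hmem : a ∈ p := by
          refine mem_of_forall_genWeightSpace_le h p (fun χ₁ a ha ↦ (hp a).mpr fun b ↦ ?_) a
          let p' : Submodule k q := LinearMap.ker ((B.compr₂ (E x) - B.compl₂ (E x) - B.comp (E x)) a)
          refine mem_of_forall_genWeightSpace_le h p' (fun χ₂ b hb ↦ ?_) b
          change E x ⁅a, b⁆ - ⁅a, E x b⁆ - ⁅E x a, b⁆ = 0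
          -- The Leibniz rule is the additivity of weights under the bracket.
          rw [hE _ _ (lie_mem_genWeightSpace_of_mem_genWeightSpace ha hb), hE _ _ ha, hE _ _ hb,
            lie_smul, smul_lie, Pi.add_apply, add_smul]
          abel
        have := (hp a).mp hmem b
        rw [← lie_skew b, sub_neg_eq_add, ← sub_eq_zero, ← this]
        abel }
  have hF (χ : h → k) (v : q) (hv : v ∈ genWeightSpace q χ) (x : h) : F x v = χ x • v := hE χ v hv x
  have hext (D₁ D₂ : LieDerivation k q q)
      (hD : ∀ χ : h → k, ∀ v ∈ genWeightSpace q χ, D₁ v = D₂ v) : D₁ = D₂ := by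
    ext v
    exact mem_of_forall_genWeightSpace_le h (LinearMap.eqLocus (D₁ : q →ₗ[k] q) (D₂ : q →ₗ[k] q))
      (fun χ v hv ↦ hD χ v hv) v
  refine ⟨{ toFun := F, map_add' := fun x y ↦ ?_, map_smul' := fun c x ↦ ?_ }, hF⟩
  · refine hext _ _ fun χ v hv ↦ ?_
    rw [LieDerivation.add_apply, hF χ v hv, hF χ v hv, hF χ v hv]
    by_cases hχ : genWeightSpace q χ = ⊥
    · rw [hχ, LieSubmodule.mem_bot] at hv
      simp [hv]
    · rw [LinearWeights.map_add (M := q) χ hχ, add_smul]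
  · refine hext _ _ fun χ v hv ↦ ?_
    rw [LieDerivation.smul_apply, hF χ v hv, hF χ v hv]
    by_cases hχ : genWeightSpace q χ = ⊥
    · rw [hχ, LieSubmodule.mem_bot] at hv
      simp [hv]
    · rw [LinearWeights.map_smul (M := q) χ hχ, smul_assoc]; rfl

section

variable {h : LieSubalgebra k q} [LieRing.IsNilpotent h] {D : h →ₗ[k] LieDerivation k q q}

theorem IsSemisimplePart.apply_eq_zero_of_commute (hD : IsSemisimplePart D) (x : h) {v : q} (hv : ∀ y ∈ h, ⁅y, v⁆ = 0) : D x v = 0 := by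
  rw [hD 0 v _ x, Pi.zero_apply, zero_smul]
  rw [mem_genWeightSpace]
  exact fun y ↦ ⟨1, by simpa using hv y y.2⟩

theorem IsSemisimplePart.apply_self_eq_zero (hD : IsSemisimplePart D) (x y : h) : D x (y : q) = 0 := by
  rw [hD 0 _ (toLieSubmodule_le_rootSpace_zero k q h y.2) x, Pi.zero_apply, zero_smul]

theorem IsSemisimplePart.apply_comm (hD : IsSemisimplePart D) (x y : h) (v : q) : D x (D y v) = D y (D x v) := by
  refine mem_of_forall_genWeightSpace_le h (LinearMap.ker
    ((D x : q →ₗ[k] q) ∘ₗ (D y : q →ₗ[k] q) - (D y : q →ₗ[k] q) ∘ₗ (D x : q →ₗ[k] q)))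
    (fun χ v hv ↦ ?_) v |> sub_eq_zero.mp
  change D x (D y v) - D y (D x v) = 0
  rw [hD χ v hv, hD χ v hv, map_smul, map_smul, hD χ v hv, hD χ v hv, smul_comm, sub_self]

/-- On a weight space with `χ x ≠ 0` every vector is in the range of `ad x`; on the others `D x`
vanishes. -/
theorem IsSemisimplePart.apply_mem_of_range_le (hD : IsSemisimplePart D) (x : h) {p : Submodule k q} (hp : ∀ v, ⁅(x : q), v⁆ ∈ p) (v : q) :
    D x v ∈ p := by
  refine mem_of_forall_genWeightSpace_le h (p.comap (D x : q →ₗ[k] q)) (fun χ v hv ↦ ?_) v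
  change D x v ∈ p
  rw [hD χ v hv]
  by_cases h0 : χ x = 0
  · rw [h0, zero_smul]; exact zero_mem _
  · obtain ⟨n, hn⟩ := (mem_genWeightSpace q χ v).mp hv x
    obtain ⟨w, rfl⟩ := Module.End.mem_range_of_pow_sub_algebraMap_apply_eq_zero h0 n v hn
    exact p.smul_mem _ (hp w)

theorem IsSemisimplePart.eq_zero_of_isNilpotent_ad (hD : IsSemisimplePart D) (x : h) (hx : IsNilpotent (ad k q x)) : D x = 0 := by
  ext v
  refine mem_of_forall_genWeightSpace_le h (LinearMap.ker (D x : q →ₗ[k] q)) (fun χ v hv ↦ ?_) v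
  change D x v = 0
  rw [hD χ v hv]
  by_cases hχ : genWeightSpace q χ = ⊥
  · rw [LieSubmodule.mem_toSubmodule, hχ, LieSubmodule.mem_bot] at hv
    rw [hv, smul_zero]
  · rw [show χ x = 0 from Weight.apply_eq_zero_of_isNilpotent (M := q) x hx ⟨χ, hχ⟩, zero_smul]

theorem IsSemisimplePart.isNilpotent_ad_sub (hD : IsSemisimplePart D) (x : h) : IsNilpotent (ad k q x - (D x : q →ₗ[k] q)) := by
  rw [Module.End.isNilpotent_iff_of_finite]
  intro v
  have : v ∈ Module.End.maxGenEigenspace (ad k q x - (D x : q →ₗ[k] q)) 0 := by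
    refine mem_of_forall_genWeightSpace_le h _ (fun χ v hv ↦ ?_) v
    obtain ⟨n, hn⟩ := (mem_genWeightSpace q χ v).mp hv x
    rw [Module.End.mem_maxGenEigenspace]
    refine ⟨n, ?_⟩
    rw [zero_smul, sub_zero]
    have key : ((ad k q x - (D x : q →ₗ[k] q)) ^ n) v = ((toEnd k h q x - χ x • 1) ^ n) v ∧
        ((toEnd k h q x - χ x • 1) ^ n) v ∈ genWeightSpace q χ := by
      clear hn
      induction n with
      | zero => exact ⟨rfl, hv⟩
      | succ n ih =>
        rw [pow_succ', pow_succ', Module.End.mul_apply, Module.End.mul_apply, ih.1]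
        have h1 := hD χ _ ih.2 x
        refine ⟨?_, ?_⟩
        · change ⁅(x : q), _⁆ - D x _ = ⁅x, _⁆ - χ x • _
          rw [h1]; rfl
        · exact sub_mem (LieSubmodule.lie_mem _ ih.2) (SMulMemClass.smul_mem _ ih.2)
    rw [key.1, hn]
  simpa using this

end

end LieAlgebra

/-! ### The extension `g` and its decomposition -/

namespace LieAlgebra

open LieModule

variable {k q : Type*} [Field k] [CharZero k] [IsAlgClosed k] [LieRing q] [LieAlgebra k q]
  [FiniteDimensional k q]

/-- The image of a family of commuting derivations, as an abelian Lie algebra of derivations. -/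
def IsSemisimplePart.torus {h : LieSubalgebra k q} [LieRing.IsNilpotent h]
    {D : h →ₗ[k] LieDerivation k q q} (hD : IsSemisimplePart D) :
    LieSubalgebra k (LieDerivation k q q) where
  toSubmodule := LinearMap.range D
  lie_mem' := by
    rintro _ _ ⟨x, rfl⟩ ⟨y, rfl⟩
    exact ⟨0, by ext v; simp [hD.apply_comm x y v]⟩

instance {R K L : Type*} [Field R] [LieRing K] [LieAlgebra R K] [LieRing L] [LieAlgebra R L]
    [FiniteDimensional R K] [FiniteDimensional R L] (ψ : L →ₗ⁅R⁆ LieDerivation R K K) :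
    FiniteDimensional R (K ⋊⁅ψ⁆ L) :=
  (SemiDirectSum.toProdl ψ).symm.finiteDimensional

variable (k q) in
/-- A Levi decomposition of `q`, with a nilpotent subalgebra `h` of the radical that centralizes the
Levi subalgebra and spans the radical modulo `⁅q, rad q⁆`, and the semisimple part of the adjoint
action of `h`. -/
structure SplitData (S : Type*) [LieRing S] [LieAlgebra k S] where
  /-- The projection onto the semisimple quotient. -/
  f : q →ₗ⁅k⁆ S
  /-- The Levi section. -/
  σ : S →ₗ⁅k⁆ q
  f_σ : ∀ x, f (σ x) = x
  f_eq_zero : ∀ x, f x = 0 ↔ x ∈ radical k q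
  /-- The nilpotent subalgebra of the radical. -/
  h : LieSubalgebra k q
  nilp : LieRing.IsNilpotent h
  h_le : ∀ x ∈ h, x ∈ radical k q
  lie_h : ∀ x ∈ h, ∀ s, ⁅σ s, x⁆ = 0
  exists_h : ∀ x ∈ radical k q, ∃ y ∈ h, x - y ∈ ⁅(⊤ : LieIdeal k q), radical k q⁆
  /-- The semisimple parts of the elements of `h`. -/
  D : h →ₗ[k] LieDerivation k q q
  isSemisimplePart : IsSemisimplePart D

variable (k q) in
theorem nonempty_splitData : Nonempty (SplitData k q (q ⧸ radical k q)) := by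
  let f := quotientMk (radical k q)
  have : IsSolvable f.ker := by
    rw [LieIdeal.solvable_iff_le_radical]
    exact fun x hx ↦ quotientMk_eq_zero.mp hx
  obtain ⟨σ, hσ⟩ := exists_rightInverse_of_hasTrivialRadical f (quotientMk_surjective _)
  obtain ⟨h, h1, h2, h3, h4⟩ := exists_isNilpotent_radical_le_sup σ
  obtain ⟨D, hD⟩ := exists_isSemisimplePart h
  exact ⟨⟨f, σ, hσ, fun x ↦ quotientMk_eq_zero, h, h1, h2, h3, h4, D, hD⟩⟩

namespace SplitData

attribute [instance] SplitData.nilp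

variable {S : Type*} [LieRing S] [LieAlgebra k S] [FiniteDimensional k S] [HasTrivialRadical k S]
  (A : SplitData k q S)

/-- The torus of semisimple parts. -/
abbrev t : LieSubalgebra k (LieDerivation k q q) := A.isSemisimplePart.torus

/-- The extension of `q` by the semisimple parts of elements of `h`. -/
abbrev g : Type _ := q ⋊⁅A.t.incl⁆ A.t

theorem t_apply_σ (τ : A.t) (s : S) : (τ : LieDerivation k q q) (A.σ s) = 0 := by
  obtain ⟨_, x, rfl⟩ := τ
  exact A.isSemisimplePart.apply_eq_zero_of_commute x fun y hy ↦ by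
    rw [← lie_skew, A.lie_h y hy, neg_zero]

theorem t_apply_h (τ : A.t) (y : A.h) : (τ : LieDerivation k q q) y = 0 := by
  obtain ⟨_, x, rfl⟩ := τ
  exact A.isSemisimplePart.apply_self_eq_zero x y

theorem t_apply_mem (τ : A.t) (v : q) :
    (τ : LieDerivation k q q) v ∈ ⁅(⊤ : LieIdeal k q), radical k q⁆ := by
  obtain ⟨_, x, rfl⟩ := τ
  refine A.isSemisimplePart.apply_mem_of_range_le x (p := (⁅(⊤ : LieIdeal k q), radical k q⁆ :
    LieIdeal k q).toSubmodule) (fun v ↦ ?_) v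
  rw [← lie_skew]
  exact neg_mem (LieSubmodule.lie_mem_lie (LieSubmodule.mem_top v) (A.h_le x x.2))

theorem t_lie (τ τ' : A.t) : ⁅τ, τ'⁆ = 0 := by
  obtain ⟨_, x, rfl⟩ := τ
  obtain ⟨_, y, rfl⟩ := τ'
  ext v
  change D A x (D A y v) - D A y (D A x v) = 0
  rw [A.isSemisimplePart.apply_comm, sub_self]

instance : IsLieAbelian A.t := ⟨A.t_lie⟩

/-- The element of the torus attached to an element of `h`. -/
def toT (x : A.h) : A.t := ⟨A.D x, x, rfl⟩

/-- The reductive subalgebra: the Levi subalgebra together with the torus. -/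
def p : LieSubalgebra k A.g where
  carrier := {y | ∃ s, y.left = A.σ s}
  zero_mem' := ⟨0, by simp⟩
  add_mem' := by
    rintro a b ⟨s, hs⟩ ⟨s', hs'⟩
    exact ⟨s + s', by simp [hs, hs']⟩
  smul_mem' := by
    rintro c a ⟨s, hs⟩
    exact ⟨c • s, by simp [hs]⟩
  lie_mem' := by
    rintro a b ⟨s, hs⟩ ⟨s', hs'⟩
    exact ⟨⁅s, s'⁆, by simp [hs, hs', t_apply_σ]⟩

theorem radical_mem_of_mem_lie {m : q} (hm : m ∈ ⁅(⊤ : LieIdeal k q), radical k q⁆) :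
    m ∈ radical k q := LieSubmodule.lie_le_right _ _ hm

/-- The nilpotent ideal: elements of the radical minus their semisimple parts. -/
def n : LieIdeal k A.g where
  carrier := {y | ∃ x : A.h, y.left - x ∈ ⁅(⊤ : LieIdeal k q), radical k q⁆ ∧ y.right = - A.toT x}
  zero_mem' := ⟨0, by simp, by ext; simp [toT]⟩
  add_mem' := by
    rintro a b ⟨x, hx, hx'⟩ ⟨y, hy, hy'⟩
    refine ⟨x + y, ?_, ?_⟩
    · have := add_mem hx hy
      rwa [sub_add_sub_comm] at this
    · rw [SemiDirectSum.add_eq_mk, hx', hy']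
      ext v
      simp [toT]
      abel
  smul_mem' := by
    rintro c a ⟨x, hx, hx'⟩
    refine ⟨c • x, ?_, ?_⟩
    · have := SMulMemClass.smul_mem c hx
      rwa [smul_sub] at this
    · rw [SemiDirectSum.smul_eq_mk, hx']
      ext v
      simp [toT]
  lie_mem := by
    rintro a b ⟨x, hx, hx'⟩
    -- All brackets of `g` with `n` lie in `[q, rad q]`, since `t` is abelian and maps `q` there;
    -- hence the witness `0`.
    refine ⟨0, ?_, ?_⟩
    · rw [SemiDirectSum.lie_eq_mk]
      have hb : b.left ∈ radical k q := by
        have := add_mem (radical_mem_of_mem_lie hx) (A.h_le x x.2)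
        rwa [sub_add_cancel] at this
      rw [ZeroMemClass.coe_zero, sub_zero]
      exact sub_mem (add_mem (LieSubmodule.lie_mem_lie (LieSubmodule.mem_top _) hb)
        (A.t_apply_mem _ _)) (A.t_apply_mem _ _)
    · rw [SemiDirectSum.lie_eq_mk, A.t_lie]
      ext
      simp [toT]

theorem left_mem_radical {y : A.g} (hy : y ∈ A.n) : y.left ∈ radical k q := by
  obtain ⟨x, hx, -⟩ := hy
  have := add_mem (radical_mem_of_mem_lie hx) (A.h_le x x.2)
  rwa [sub_add_cancel] at this

/-- In the intersection the `q`-component lies in both the Levi subalgebra and the radical, so it is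
zero. Then `x ∈ [q, rad q]` is ad-nilpotent, and its semisimple part is zero as well. -/
theorem isCompl : IsCompl A.p.toSubmodule A.n.toSubmodule := by
  constructor
  · rw [Submodule.disjoint_def]
    rintro y ⟨s, hs⟩ hy
    have h1 := A.left_mem_radical hy
    obtain ⟨x, hx, hx'⟩ := hy
    rw [← A.f_eq_zero, hs, A.f_σ] at h1
    rw [h1, map_zero] at hs
    rw [hs, zero_sub, neg_mem_iff] at hx
    have h2 : A.toT x = 0 := Subtype.ext
      (A.isSemisimplePart.eq_zero_of_isNilpotent_ad x (isNilpotent_ad_of_mem_lie_radical hx))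
    rw [h2, neg_zero] at hx'
    exact SemiDirectSum.ext hs hx'
  · rw [codisjoint_iff, eq_top_iff]
    rintro y -
    have h1 : y.left - A.σ (A.f y.left) ∈ radical k q := by
      rw [← A.f_eq_zero, map_sub, A.f_σ, sub_self]
    obtain ⟨x, hx, hx'⟩ := A.exists_h _ h1
    refine Submodule.mem_sup.mpr ⟨⟨A.σ (A.f y.left), y.right + A.toT ⟨x, hx⟩⟩, ⟨_, rfl⟩,
      ⟨y.left - A.σ (A.f y.left), - A.toT ⟨x, hx⟩⟩, ⟨⟨x, hx⟩, hx', rfl⟩, ?_⟩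
    ext <;> simp

/-- The projection of `p` onto the semisimple `S` kills the radical, which therefore lies in the
torus. -/
theorem radical_p_le {z : A.p} (hz : z ∈ radical k A.p) : (z : A.g).left = 0 := by
  let F : A.p →ₗ⁅k⁆ S :=
    { toFun := fun y ↦ A.f (y : A.g).left
      map_add' := fun x y ↦ by simp
      map_smul' := fun c x ↦ by simp
      map_lie' := by
        rintro ⟨x, s, hs⟩ ⟨y, s', hs'⟩
        simp [hs, hs', t_apply_σ] }
  have hF : Function.Surjective F := fun s ↦ ⟨⟨⟨A.σ s, 0⟩, s, rfl⟩, A.f_σ s⟩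
  have h1 : A.f (z : A.g).left = 0 := radical_le_ker F hF hz
  obtain ⟨s, hs⟩ := z.2
  rw [hs, A.f_σ] at h1
  rw [hs, h1, map_zero]

theorem lie_eq_zero_of_mem_radical_p {z : A.p} (hz : z ∈ radical k A.p) (y : A.p) : ⁅y, z⁆ = 0 := by
  have h1 := A.radical_p_le hz
  obtain ⟨s, hs⟩ := y.2
  ext
  · simp [h1, hs, t_apply_σ]
  · simp [A.t_lie]

theorem hasCentralRadical_p : HasCentralRadical k A.p :=
  hasCentralRadical_of_radical_le k A.p fun z hz ↦ (mem_maxTrivSubmodule k A.p A.p z).mpr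
    fun y ↦ A.lie_eq_zero_of_mem_radical_p hz y

theorem isSemisimple_ad_inr (τ : A.t) :
    (ad k A.g ⟨0, τ⟩).IsSemisimple := by
  obtain ⟨_, x, rfl⟩ := τ
  refine Module.End.isSemisimple_of_iSup_eigenspace_eq_top (eq_top_iff.mpr ?_)
  set E := ⨆ μ, Module.End.eigenspace (ad k A.g ⟨0, ⟨A.D x, x, rfl⟩⟩) μ with hE
  have h1 (v : q) : (⟨v, 0⟩ : A.g) ∈ E := by
    refine mem_of_forall_genWeightSpace_le A.h (E.comap (SemiDirectSum.inl A.t.incl : q →ₗ[k] A.g))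
      (fun χ v hv ↦ ?_) v
    refine Submodule.mem_iSup_of_mem (χ x) ?_
    rw [Module.End.mem_eigenspace_iff]
    ext
    · simpa using A.isSemisimplePart χ v hv x
    · simp
  have h2 (τ : A.t) : (⟨0, τ⟩ : A.g) ∈ E := by
    refine Submodule.mem_iSup_of_mem 0 ?_
    rw [Module.End.mem_eigenspace_iff]
    ext
    · simp
    · simp [A.t_lie]
  rintro y -
  have := add_mem (h1 y.left) (h2 y.right)
  simpa using this

theorem complementedLattice : ComplementedLattice (LieSubmodule k A.p A.n) := by
  refine IsReductiveAction.complementedLattice ⟨fun z hz ↦ ?_, fun z hz y v ↦ ?_⟩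
  · have h1 : (z : A.g) = ⟨0, (z : A.g).right⟩ := SemiDirectSum.ext (A.radical_p_le hz) rfl
    have h2 := A.isSemisimple_ad_inr (z : A.g).right
    rw [← h1] at h2
    exact h2.restrict (p := A.n.toSubmodule) (fun _ hv ↦ A.n.lie_mem hv)
  · rw [leibniz_lie, A.lie_eq_zero_of_mem_radical_p hz, zero_lie, zero_add]

/-- The preimage of the radical in the extension. -/
def r : LieIdeal k A.g where
  toSubmodule := (radical k q).toSubmodule.comap (SemiDirectSum.projl A.t.incl)
  lie_mem := fun hb ↦ sub_mem (add_mem ((radical k q).lie_mem hb)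
    (radical_mem_of_mem_lie (A.t_apply_mem _ _))) (radical_mem_of_mem_lie (A.t_apply_mem _ _))

theorem mem_r {y : A.g} : y ∈ A.r ↔ y.left ∈ radical k q := Iff.rfl

instance : IsSolvable A.r := by
  let F : A.r →ₗ⁅k⁆ A.t := (SemiDirectSum.projr A.t.incl).comp A.r.incl
  let G : F.ker →ₗ⁅k⁆ radical k q :=
    { toFun := fun y ↦ ⟨(y : A.r).1.left, A.mem_r.mp (y : A.r).2⟩
      map_add' := fun x y ↦ rfl
      map_smul' := fun c x ↦ rfl
      map_lie' := by
        rintro ⟨x, hx⟩ ⟨y, hy⟩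
        have hx : x.1.right = 0 := hx
        have hy : y.1.right = 0 := hy
        ext
        simp [hx, hy] }
  have hG : Function.Injective G := by
    intro x y hxy
    have h1 : (x : A.r).1.left = (y : A.r).1.left := congrArg Subtype.val hxy
    have hx : (x : A.r).1.right = 0 := x.2
    have hy : (y : A.r).1.right = 0 := y.2
    exact Subtype.ext (Subtype.ext (SemiDirectSum.ext h1 (hx.trans hy.symm)))
  have : IsSolvable F.ker := hG.lieAlgebra_isSolvable
  exact isSolvable_of_isSolvable_ker F

/-- The operator maps `g` into `q`, because `t` is abelian and kills `h`, and on `q` it is `ad x - D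
x`. The step into `q` costs one extra power. -/
theorem isNilpotent_ad_sub (x : A.h) : IsNilpotent (ad k A.g ⟨x, - A.toT x⟩) := by
  obtain ⟨m, hm⟩ := A.isSemisimplePart.isNilpotent_ad_sub x
  set N := ad k q x - (A.D x : q →ₗ[k] q)
  have h1 (y : A.g) : ad k A.g ⟨x, - A.toT x⟩ y = ⟨N y.left, 0⟩ := by
    ext
    · simp [t_apply_h, N, toT]
      abel
    · simp [A.t_lie]
  have h2 (j : ℕ) (y : A.g) : ((ad k A.g ⟨x, - A.toT x⟩) ^ (j + 1)) y = ⟨(N ^ (j + 1)) y.left, 0⟩ := by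
    induction j with
    | zero => simpa using h1 y
    | succ j ih => rw [pow_succ', Module.End.mul_apply, ih, h1, pow_succ' N (j + 1)]; rfl
  refine ⟨m + 1, LinearMap.ext fun y ↦ ?_⟩
  rw [h2, pow_succ, hm, zero_mul]
  rfl

/-- By Engel's theorem it suffices that each element `(x - D x) + m` with `m ∈ [q, rad q]` is
ad-nilpotent. Since `m ∈ [g, r]` with `r` solvable, it does not affect nilpotency. -/
theorem isNilpotent_n : LieRing.IsNilpotent A.n := by
  rw [LieAlgebra.isNilpotent_iff_forall (R := k)]
  rintro ⟨y, hy⟩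
  apply LieSubalgebra.isNilpotent_ad_of_isNilpotent_ad (A.n : LieSubalgebra k A.g) (x := ⟨y, hy⟩)
  obtain ⟨x, hx, hx'⟩ := hy
  have h1 : y = ⟨x, - A.toT x⟩ + ⟨y.left - x, 0⟩ := by
    ext <;> simp [hx']
  change IsNilpotent (ad k A.g y)
  rw [h1]
  refine isNilpotent_toEnd_add_of_mem_lie (V := A.g) A.r (A.h_le x x.2) (A.isNilpotent_ad_sub x) ?_
  generalize y.left - (x : q) = m at hx
  rw [← LieSubmodule.mem_toSubmodule, LieSubmodule.lieIdeal_oper_eq_linear_span'] at hx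
  change SemiDirectSum.inl A.t.incl m ∈ _
  induction hx using Submodule.span_induction with
  | mem n hn =>
    obtain ⟨a, -, b, hb, rfl⟩ := hn
    rw [LieHom.map_lie]
    exact LieSubmodule.lie_mem_lie (LieSubmodule.mem_top _) hb
  | zero => rw [map_zero]; exact zero_mem _
  | add n n' _ _ h h' => rw [map_add]; exact add_mem h h'
  | smul c n _ h => rw [map_smul]; exact SMulMemClass.smul_mem c h

end SplitData

end LieAlgebra

/-- Every finite-dimensional complex Lie algebra `q` embeds into a finite-dimensional Lie algebra
`g` that is the (internal) semidirect product of a reductive subalgebra `p` and a nilpotent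
ideal `n`, such that the action of `p` on `n` (by the bracket of `g`) is completely reducible.
Over a field of characteristic zero, `LieAlgebra.HasCentralRadical` (the radical is the center)
is the usual notion of a reductive Lie algebra. -/
theorem lemma1 (q : Type u) [LieRing q] [LieAlgebra ℂ q] [FiniteDimensional ℂ q] :
    ∃ (g : Type u) (_ : LieRing g) (_ : LieAlgebra ℂ g)
      (f : q →ₗ⁅ℂ⁆ g) (p : LieSubalgebra ℂ g) (n : LieIdeal ℂ g),
      FiniteDimensional ℂ g ∧
      Function.Injective f ∧
      IsCompl p.toSubmodule n.toSubmodule ∧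
      LieAlgebra.HasCentralRadical ℂ p ∧
      LieRing.IsNilpotent n ∧
      ComplementedLattice (LieSubmodule ℂ p n) := by
  obtain ⟨A⟩ := LieAlgebra.nonempty_splitData ℂ q
  exact ⟨A.g, inferInstance, inferInstance, LieAlgebra.SemiDirectSum.inl A.t.incl, A.p, A.n,
    inferInstance, LieAlgebra.SemiDirectSum.inl_injective _, A.isCompl, A.hasCentralRadical_p,
    A.isNilpotent_n, A.complementedLattice⟩
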